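/- Let $g\ge 1$, $n\ge 0$ be integers and let $S$ be a closed (compact, without boundary), connected, oriented topological surface of genus $g$. Let $\alpha_1,\beta_1,\dots,\alpha_g,\beta_g$ be a standard generating system of its fundamental group, so that $$\pi_1 S=\Big\langle \alpha_1,\beta_1,\dots,\alpha_g,\beta_g \;\Big|\; \prod_{i=1}^g[\alpha_i,\beta_i]=1\Big\rangle .$$ Let $\mathrm H_1(S,\mathbb Z)\cong \pi_1S/[\pi_1S,\pi_1S]\cong\mathbb Z^{2g}$ be the first homology group, with the algebraic intersection form $\cap$, that is, the alternating bilinear form with $[\alpha_i]\cap[\alpha_j]=[\beta_i]\cap[\beta_j]=0$ and $[\alpha_i]\cap[\beta_j]=\delta_{ij}$, and let $\mathrm{Sp}(2g,\mathbb Z)$ be the group of the automorphisms of $\mathrm H_1(S,\mathbb Z)$ that preserve $\cap$. Let $\mathbb T^n=(\mathbb S^1)^n$ be the $n$-dimensional torus, and let $\mathsf{Hom}(\mathrm H_1(S,\mathbb Z),\mathbb T^n)$ be the space of group homomorphisms with the compact-open topology, where $\mathrm H_1(S,\mathbb Z)$ is discrete (it is homeomorphic to $\mathbb T^{2gn}$).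 The group $\mathrm{Sp}(2g,\mathbb Z)$ acts on it by precomposition, $\phi\cdot\overline\rho=\overline\rho\circ\phi^{-1}$. Then for every homomorphism $\overline\rho:\mathrm H_1(S,\mathbb Z)\to\mathbb T^n$ the image of $\overline\rho$ is dense in $\mathbb T^n$ if and only if the orbit $\mathrm{Sp}(2g,\mathbb Z)\cdot\overline\rho$ is dense in $\mathsf{Hom}(\mathrm H_1(S,\mathbb Z),\mathbb T^n)$. -/

import Mathlib

/-- The surface relator, the product of commutators `[α₁, β₁] ⋯ [α_g, β_g]`, in the free group on the letters
`α i = Sum.inl i` and `β i = Sum.inr i`. -/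
def surfaceRelator (g : ℕ) : FreeGroup (Fin g ⊕ Fin g) :=
  (List.ofFn fun i : Fin g =>
    FreeGroup.of (Sum.inl i) * FreeGroup.of (Sum.inr i) *
      (FreeGroup.of (Sum.inl i))⁻¹ * (FreeGroup.of (Sum.inr i))⁻¹).prod

/-- The group `⟨α₁, β₁, …, α_g, β_g ∣ [α₁, β₁] ⋯ [α_g, β_g] = 1⟩`. -/
abbrev SurfaceGroup (g : ℕ) : Type := PresentedGroup {surfaceRelator g}

/-- The first integral homology group of a path connected space `S` with base point `x`, as the
abelianization of the fundamental group. It is written multiplicatively. -/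
def H1 (S : Type*) [TopologicalSpace S] (x : S) : Type _ :=
  Abelianization (FundamentalGroup S x)

namespace H1

variable {S : Type*} [TopologicalSpace S] {x : S}

noncomputable instance : CommGroup (H1 S x) :=
  inferInstanceAs (CommGroup (Abelianization (FundamentalGroup S x)))

/-- Homology is a discrete group. -/
instance : TopologicalSpace (H1 S x) := ⊥

instance : DiscreteTopology (H1 S x) := ⟨rfl⟩

end H1

/-- In a commutative group, any choice of images of the generators satisfies the surface
relation. -/
theorem lift_surfaceRelator {A : Type*} [CommGroup A] (g : ℕ) (f : Fin g ⊕ Fin g → A) :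
    ∀ r ∈ ({surfaceRelator g} : Set (FreeGroup (Fin g ⊕ Fin g))), FreeGroup.lift f r = 1 := by
  rintro r rfl
  rw [surfaceRelator, map_list_prod, List.map_ofFn]
  apply List.prod_eq_one
  intro a ha
  obtain ⟨i, rfl⟩ := (List.mem_ofFn' _ _).1 ha
  simp [mul_comm]

/-- The exponent-sum homomorphism of the surface group: it sends the generator `k` to the `k`-th
standard basis vector of `ℤ^{2g}`. -/
noncomputable def SurfaceGroup.exponents (g : ℕ) :
    SurfaceGroup g →* Multiplicative (Fin g ⊕ Fin g → ℤ) :=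
  PresentedGroup.toGroup
    (lift_surfaceRelator g fun k => Multiplicative.ofAdd (Pi.single k (1 : ℤ)))

section Surface

variable {S : Type*} [TopologicalSpace S] {x : S} {g : ℕ}

/-- The coordinates of a homology class in the basis `[α₁], …, [α_g], [β₁], …, [β_g]` of `H₁`, for
the standard generating system `α i = e (Sum.inl i)`, `β i = e (Sum.inr i)` of the fundamental
group. -/
noncomputable def H1.coords (e : SurfaceGroup g ≃* FundamentalGroup S x) (a : H1 S x) :
    Fin g ⊕ Fin g → ℤ :=
  Multiplicative.toAdd
    (Abelianization.lift ((SurfaceGroup.exponents g).comp e.symm.toMonoidHom) a)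

/-- The algebraic intersection form `∩` on `H₁`: the alternating bilinear form with
`[α i] ∩ [α j] = [β i] ∩ [β j] = 0` and `[α i] ∩ [β j] = δ i j`. (Another standard generating
system yields the same form up to a sign, that is, up to the choice of the orientation.) -/
noncomputable def H1.intersection (e : SurfaceGroup g ≃* FundamentalGroup S x)
    (a b : H1 S x) : ℤ :=
  ∑ i : Fin g, (H1.coords e a (Sum.inl i) * H1.coords e b (Sum.inr i)
    - H1.coords e a (Sum.inr i) * H1.coords e b (Sum.inl i))

/-- The symplectic group `Sp(2g, ℤ)`, as the group of the automorphisms of `H₁` which preserve the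
algebraic intersection form. -/
def H1.Sp (e : SurfaceGroup g ≃* FundamentalGroup S x) : Subgroup (MulAut (H1 S x)) where
  carrier := {φ | ∀ a b, H1.intersection e (φ a) (φ b) = H1.intersection e a b}
  mul_mem' := by
    intro φ ψ hφ hψ a b
    rw [MulAut.mul_apply, MulAut.mul_apply, hφ, hψ]
  one_mem' := fun _ _ => rfl
  inv_mem' := by
    intro φ hφ a b
    have h := hφ (φ⁻¹ a) (φ⁻¹ b)
    rw [MulAut.apply_inv_self, MulAut.apply_inv_self] at h
    exact h.symm

end Surface

/-- The torus `𝕋ⁿ`, the product of `n` unit circles. -/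
abbrev Torus (n : ℕ) : Type := Fin n → Circle

/-- The homological representation space `Hom(H₁(S, ℤ), 𝕋ⁿ)` with the compact-open topology. As
`H₁` is discrete, continuity is no restriction on the homomorphisms. -/
abbrev HomologicalRep (S : Type*) [TopologicalSpace S] (x : S) (n : ℕ) : Type _ :=
  H1 S x →ₜ* Torus n

/-- Automorphisms of `H₁` act on representations by precomposition, `φ • ρ = ρ ∘ φ⁻¹`. -/
noncomputable instance HomologicalRep.mulAction (S : Type*) [TopologicalSpace S] (x : S) (n : ℕ) :
    MulAction (MulAut (H1 S x)) (HomologicalRep S x n) where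
  smul φ ρ :=
    { toMonoidHom := ρ.toMonoidHom.comp (φ⁻¹).toMonoidHom
      continuous_toFun := continuous_of_discreteTopology }
  one_smul _ := rfl
  mul_smul _ _ _ := rfl

/-!
In the basis of homology given by the standard generators, a representation is a point of the
compact torus `(𝕋ⁿ)^{2g}`, by `HomologicalRep.valuesHomeomorph`, and the powers of the transvection
along a class `w` multiply the value of `ρ` at `a` by the powers of `ρ w` with exponents proportional
to `w ∩ a`.

Suppose that `ρ` has dense image, and let `X` be the closure of its orbit. Call a point of `𝕋ⁿ`
generic if no nontrivial character is trivial on it; by Kronecker's theorem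
(`UnitAddTorus.dense_range_nsmul`, `Torus.IsGeneric.dense_range_pow`) its powers are dense. The proof
has two steps.

* `X` contains a representation with generic values on `α₁, …, α_g`
  (`Torus.TransvectionInvariant.exists_generic`). By the Baire category theorem in `X`, it suffices
  that every point of the orbit can be moved slightly within the orbit so that a given nontrivial
  character `χ` becomes nontrivial on the value at `α i`. As the image is dense, there is a class `w`
  with `w ∩ α i ≠ 0` on which `χ ∘ ρ` has infinite order. Powers of `ρ w` return to every
  neighbourhood of `1`, so arbitrarily high powers of the transvection along `w` move `ρ` as little as
  desired.
* If the value at `α i` is generic, the powers of the transvection along `α i` show that the value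
  at `β i` can be changed at will within `X`. Once that value is generic too, the transvections
  along `β i` change the value at `α i` at will. Proceeding pair by pair, `X` is everything
  (`Torus.TransvectionInvariant.eq_univ`).

Conversely, evaluation at `α₁` is a continuous map of the representation space onto `𝕋ⁿ`, and maps
the orbit of `ρ` into the image of `ρ`.
-/

/-! ### Kronecker's theorem on the torus -/

open Filter Topology in
/-- The Cesàro means of the powers of a complex number `z ≠ 1` of modulus one tend to zero. -/
theorem tendsto_average_pow {z : ℂ} (hz : ‖z‖ = 1) (hz1 : z ≠ 1) :
    Tendsto (fun N : ℕ => (N : ℂ)⁻¹ * ∑ k ∈ Finset.range N, z ^ k) atTop (𝓝 0) := by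
  rw [tendsto_zero_iff_norm_tendsto_zero]
  have hlim : Tendsto (fun N : ℕ => (N : ℝ)⁻¹ * (2 / ‖z - 1‖)) atTop (𝓝 0) := by
    simpa using (tendsto_inv_atTop_nhds_zero_nat (𝕜 := ℝ)).mul_const (2 / ‖z - 1‖)
  refine squeeze_zero (fun _ => norm_nonneg _) (fun N => ?_) hlim
  rw [norm_mul, norm_inv, Complex.norm_natCast, geom_sum_eq hz1, norm_div]
  gcongr
  calc ‖z ^ N - 1‖ ≤ ‖z ^ N‖ + ‖(1 : ℂ)‖ := norm_sub_le _ _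
    _ = 2 := by rw [norm_pow, hz]; norm_num

section Weyl

open Filter Topology MeasureTheory UnitAddTorus

variable {d : Type*} [Fintype d]

theorem UnitAddTorus.mFourier_add_arg (m : d → ℤ) (x y : UnitAddTorus d) :
    mFourier m (x + y) = mFourier m x * mFourier m y := by
  simp [mFourier, Finset.prod_mul_distrib, fourier_apply, smul_add, AddCircle.toCircle_add]

theorem UnitAddTorus.mFourier_nsmul_arg (m : d → ℤ) (x : UnitAddTorus d) (k : ℕ) :
    mFourier m (k • x) = mFourier m x ^ k := by
  induction k with
  | zero => simp [mFourier]
  | succ k ih => rw [succ_nsmul, mFourier_add_arg, ih, pow_succ]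

theorem UnitAddTorus.norm_mFourier_apply (m : d → ℤ) (x : UnitAddTorus d) :
    ‖mFourier m x‖ = 1 := by
  simp only [mFourier, ContinuousMap.coe_mk, norm_prod, fourier_apply, Circle.norm_coe,
    Finset.prod_const_one]

/-- Weyl's equidistribution for trigonometric polynomials: the averages along the multiples of a
point on which no nontrivial character is trivial converge to the Haar integral. -/
theorem UnitAddTorus.tendsto_average_of_mem_span {x : UnitAddTorus d}
    (hx : ∀ m : d → ℤ, m ≠ 0 → mFourier m x ≠ 1)
    (μ : Measure (UnitAddTorus d)) [μ.IsAddHaarMeasure] [IsProbabilityMeasure μ]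
    {p : C(UnitAddTorus d, ℂ)} (hp : p ∈ Submodule.span ℂ (Set.range (mFourier (d := d)))) :
    Tendsto (fun N : ℕ => (N : ℂ)⁻¹ * ∑ k ∈ Finset.range N, p (k • x)) atTop
      (𝓝 (∫ y, p y ∂μ)) := by
  have hint : ∀ q : C(UnitAddTorus d, ℂ), Integrable (fun y => q y) μ := fun q =>
    q.continuous.integrable_of_hasCompactSupport (HasCompactSupport.of_compactSpace _)
  induction hp using Submodule.span_induction with
  | mem q hq =>
    obtain ⟨m, rfl⟩ := hq
    by_cases hm : m = 0
    · subst hm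
      simp only [mFourier_zero, ContinuousMap.one_apply, Finset.sum_const, Finset.card_range,
        nsmul_eq_mul, mul_one, integral_const, probReal_univ, one_smul]
      refine tendsto_const_nhds.congr' ?_
      filter_upwards [eventually_ne_atTop 0] with N hN
      rw [inv_mul_cancel₀ (by exact_mod_cast hN)]
    · -- the integral vanishes, as it is multiplied by `mFourier m x ≠ 1` under translation by `x`
      have h0 : ∫ y, mFourier m y ∂μ = 0 := by
        have h := integral_add_left_eq_self (μ := μ) (fun y => mFourier m y) x
        simp only [mFourier_add_arg, integral_const_mul] at h
        have h' : (mFourier m x - 1) * ∫ y, mFourier m y ∂μ = 0 := by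
          rw [sub_mul, h, one_mul, sub_self]
        exact (mul_eq_zero.1 h').resolve_left (sub_ne_zero.2 (hx m hm))
      rw [h0]
      simp only [mFourier_nsmul_arg]
      exact tendsto_average_pow (norm_mFourier_apply m x) (hx m hm)
  | zero => simp
  | add p q _ _ hp hq =>
    simp only [ContinuousMap.add_apply, Finset.sum_add_distrib, mul_add]
    rw [integral_add (hint p) (hint q)]
    exact hp.add hq
  | smul a p _ hp =>
    simp only [ContinuousMap.smul_apply, smul_eq_mul, integral_const_mul, ← Finset.mul_sum,
      mul_left_comm _ a]
    exact hp.const_mul a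

/-- Kronecker's theorem: the multiples of a point of the torus are dense if no nontrivial character
is trivial on it. -/
theorem UnitAddTorus.dense_range_nsmul {x : UnitAddTorus d}
    (hx : ∀ m : d → ℤ, m ≠ 0 → mFourier m x ≠ 1) :
    Dense (Set.range fun k : ℕ => k • x) := by
  rw [dense_iff_inter_open]
  by_contra! hcon
  obtain ⟨U, hU, ⟨u, hu⟩, hempty⟩ := hcon
  obtain ⟨f, hf0, hf1, hf01⟩ := exists_continuous_zero_one_of_isClosed hU.isClosed_compl
    (isClosed_singleton (x := u)) (by simpa using hu)
  set K₀ : TopologicalSpace.PositiveCompacts (UnitAddTorus d) := ⊤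
  set μ : Measure (UnitAddTorus d) := Measure.addHaarMeasure K₀
  have hμ : IsProbabilityMeasure μ := ⟨by
    have := Measure.addHaarMeasure_self (K₀ := K₀)
    simpa [K₀] using this⟩
  have hpos : 0 < ∫ y, f y ∂μ := by
    refine f.continuous.integral_pos_of_hasCompactSupport_nonneg_nonzero
      (HasCompactSupport.of_compactSpace _) (fun y => (hf01 y).1) (x := u) ?_
    rw [hf1 rfl]
    exact one_ne_zero
  let F : C(UnitAddTorus d, ℂ) := ⟨fun y => (f y : ℂ), by fun_prop⟩
  have hint : ∀ q : C(UnitAddTorus d, ℂ), Integrable (fun y => q y) μ := fun q =>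
    q.continuous.integrable_of_hasCompactSupport (HasCompactSupport.of_compactSpace _)
  have hFint : ∫ y, F y ∂μ = ((∫ y, f y ∂μ : ℝ) : ℂ) := integral_ofReal
  have hF0 : ∀ k : ℕ, F (k • x) = 0 := fun k => by
    have hk : k • x ∉ U := fun h =>
      (Set.eq_empty_iff_forall_notMem.1 hempty) (k • x) ⟨h, k, rfl⟩
    have h0 : f (k • x) = 0 := hf0 hk
    change ((f (k • x) : ℝ) : ℂ) = 0
    rw [h0, Complex.ofReal_zero]
  have hFcl : F ∈ closure
      ((Submodule.span ℂ (Set.range (mFourier (d := d))) : Submodule ℂ C(UnitAddTorus d, ℂ)) :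
        Set C(UnitAddTorus d, ℂ)) := by
    rw [← Submodule.topologicalClosure_coe, span_mFourier_closure_eq_top]
    trivial
  obtain ⟨p, hp, hFp⟩ := Metric.mem_closure_iff.1 hFcl ((∫ y, f y ∂μ) / 2) (half_pos hpos)
  have hclose : ∀ y, ‖F y - p y‖ ≤ dist F p := fun y => by
    rw [← dist_eq_norm]
    exact ContinuousMap.dist_apply_le_dist y
  have hpint : ‖∫ y, p y ∂μ‖ ≤ dist F p := by
    refine le_of_tendsto (tendsto_average_of_mem_span hx μ hp).norm (.of_forall fun N => ?_)
    have hsum : ‖∑ k ∈ Finset.range N, p (k • x)‖ ≤ N * dist F p := by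
      refine (norm_sum_le _ _).trans ((Finset.sum_le_card_nsmul _ _ (dist F p) fun k _ => ?_).trans
        (by simp))
      simpa [hF0 k] using hclose (k • x)
    rw [norm_mul, norm_inv, Complex.norm_natCast]
    rcases Nat.eq_zero_or_pos N with rfl | hN
    · simp
    · have hN' : (0 : ℝ) < N := by exact_mod_cast hN
      rw [inv_mul_le_iff₀ hN']
      exact hsum
  have hdiff : ‖∫ y, F y ∂μ - ∫ y, p y ∂μ‖ ≤ dist F p := by
    rw [← integral_sub (hint F) (hint p)]
    simpa using norm_integral_le_of_norm_le_const (μ := μ) (.of_forall hclose)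
  have h1 : ‖∫ y, F y ∂μ‖ ≤ dist F p + dist F p := by
    calc ‖∫ y, F y ∂μ‖ = ‖(∫ y, F y ∂μ - ∫ y, p y ∂μ) + ∫ y, p y ∂μ‖ := by rw [sub_add_cancel]
      _ ≤ _ := (norm_add_le _ _).trans (add_le_add hdiff hpint)
  rw [hFint, Complex.norm_real, Real.norm_of_nonneg hpos.le] at h1
  linarith

end Weyl

namespace Torus

variable {n : ℕ}

/-- The character of the torus with exponents `m`. -/
noncomputable def character (m : Fin n → ℤ) : Torus n →* Circle where
  toFun t := ∏ j, t j ^ m j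
  map_one' := by simp
  map_mul' s t := by simp [mul_zpow, Finset.prod_mul_distrib]

theorem character_apply (m : Fin n → ℤ) (t : Torus n) : character m t = ∏ j, t j ^ m j := rfl

theorem continuous_character (m : Fin n → ℤ) : Continuous (character m) := by
  change Continuous fun t : Torus n => ∏ j, t j ^ m j
  fun_prop

theorem character_zsmul (a : ℤ) (m : Fin n → ℤ) (t : Torus n) :
    character (a • m) t = character m t ^ a := by
  simp only [character_apply, ← Finset.prod_zpow, Pi.smul_apply, smul_eq_mul, mul_comm a, zpow_mul]

/-- A nontrivial exponent vector defines a nontrivial character. -/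
theorem exists_character_ne_one {m : Fin n → ℤ} (hm : m ≠ 0) : ∃ t, character m t ≠ 1 := by
  obtain ⟨j, hj⟩ := Function.ne_iff.1 hm
  have hj' : (m j : ℝ) ≠ 0 := by exact_mod_cast hj
  refine ⟨Pi.mulSingle j (Circle.exp (Real.pi / m j)), ?_⟩
  rw [character_apply, Finset.prod_eq_single j]
  · rw [Pi.mulSingle_eq_same, ← Circle.exp_zsmul, zsmul_eq_mul, mul_div_cancel₀ _ hj']
    intro h
    have h' := congrArg (fun z : Circle => (z : ℂ)) h
    simp only [Circle.coe_exp, Complex.exp_pi_mul_I, Circle.coe_one] at h'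
    norm_num at h'
  · intro k _ hk
    rw [Pi.mulSingle_eq_of_ne hk, one_zpow]
  · simp

/-- A point of the torus is generic if no nontrivial character is trivial on it. -/
def IsGeneric (t : Torus n) : Prop := ∀ m : Fin n → ℤ, m ≠ 0 → character m t ≠ 1

theorem IsGeneric.pow {t : Torus n} (ht : IsGeneric t) {k : ℕ} (hk : k ≠ 0) :
    IsGeneric (t ^ k) := by
  intro m hm h
  have hk' : (k : ℤ) ≠ 0 := by exact_mod_cast hk
  refine ht ((k : ℤ) • m) (smul_ne_zero hk' hm) ?_
  rw [character_zsmul, zpow_natCast, ← map_pow, h]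

/-- The powers of a generic point of the torus are dense. -/
theorem IsGeneric.dense_range_pow {t : Torus n} (ht : IsGeneric t) :
    Dense (Set.range fun k : ℕ => t ^ k) := by
  let θ : UnitAddTorus (Fin n) → Torus n := fun y j => AddCircle.toCircle (y j)
  have hθ : Continuous θ :=
    continuous_pi fun j => AddCircle.continuous_toCircle.comp (continuous_apply j)
  have hsurj : Function.Surjective θ := fun s => by
    refine ⟨fun j => (AddCircle.homeomorphCircle one_ne_zero).symm (s j), funext fun j => ?_⟩
    change AddCircle.toCircle _ = _
    rw [← AddCircle.homeomorphCircle_apply one_ne_zero, Homeomorph.apply_symm_apply]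
  obtain ⟨x, rfl⟩ := hsurj t
  have hx : ∀ m : Fin n → ℤ, m ≠ 0 → UnitAddTorus.mFourier m x ≠ 1 := fun m hm h => by
    refine ht m hm (Circle.ext ?_)
    rw [Circle.coe_one, ← h]
    change Circle.coeHom _ = _
    simp [character_apply, map_prod, θ, UnitAddTorus.mFourier, fourier_apply,
      AddCircle.toCircle_zsmul]
    rfl
  have h := hsurj.denseRange.dense_image hθ (UnitAddTorus.dense_range_nsmul hx)
  rw [← Set.range_comp] at h
  convert h using 3 with k
  funext j
  simp [θ, AddCircle.toCircle_nsmul]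

/-- The positive powers of a generic point are dense as well. -/
theorem IsGeneric.dense_range_pow_succ {t : Torus n} (ht : IsGeneric t) :
    Dense (Set.range fun k : ℕ => t ^ (k + 1)) := by
  have h := (Homeomorph.mulRight t).surjective.denseRange.dense_image
    (Homeomorph.mulRight t).continuous ht.dense_range_pow
  rw [← Set.range_comp] at h
  convert h using 3 with k
  simp [pow_succ]

end Torus

/-! ### Transvections in coordinates -/

namespace Torus

open Topology Filter

variable {g n : ℕ}

/-- The value at the vector `w` of the homomorphism `ℤ^{2g} → 𝕋ⁿ` which takes the values `c` on the
standard basis. -/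
noncomputable def evalAt (c : Fin g ⊕ Fin g → Torus n) (w : Fin g ⊕ Fin g → ℤ) : Torus n :=
  ∏ k, c k ^ w k

theorem evalAt_add (c : Fin g ⊕ Fin g → Torus n) (v w : Fin g ⊕ Fin g → ℤ) :
    evalAt c (v + w) = evalAt c v * evalAt c w := by
  simp [evalAt, zpow_add, Finset.prod_mul_distrib]

theorem evalAt_single (c : Fin g ⊕ Fin g → Torus n) (k : Fin g ⊕ Fin g) :
    evalAt c (Pi.single k 1) = c k := by
  rw [evalAt, Finset.prod_eq_single k]
  · rw [Pi.single_eq_same, zpow_one]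
  · intro l _ hl
    rw [Pi.single_eq_of_ne hl, zpow_zero]
  · simp

theorem continuous_evalAt (w : Fin g ⊕ Fin g → ℤ) :
    Continuous fun c : Fin g ⊕ Fin g → Torus n => evalAt c w := by
  unfold evalAt
  fun_prop

/-- The intersection numbers of the vector `w` with the standard basis vectors. -/
def pairing (w : Fin g ⊕ Fin g → ℤ) : Fin g ⊕ Fin g → ℤ :=
  Sum.elim (fun i => -w (Sum.inr i)) (fun i => w (Sum.inl i))

theorem pairing_add (v w : Fin g ⊕ Fin g → ℤ) : pairing (v + w) = pairing v + pairing w := by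
  funext k
  rcases k with i | i <;> simp [pairing, add_comm]

theorem pairing_single_inl (i : Fin g) :
    pairing (Pi.single (Sum.inl i) 1) = Pi.single (Sum.inr i) (1 : ℤ) := by
  funext k
  rcases k with j | j <;> simp [pairing, Pi.single_apply]

theorem pairing_single_inr (i : Fin g) :
    pairing (Pi.single (Sum.inr i) 1) = Pi.single (Sum.inl i) (-1 : ℤ) := by
  funext k
  rcases k with j | j <;> simp [pairing, Pi.single_apply, apply_ite Neg.neg]

/-- Move the value on each basis vector `k` by `s` to the intersection number of `w` with `k`. For
`s` a power of `evalAt c w` this is the effect of a power of the transvection along `w`. -/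
noncomputable def shear (w : Fin g ⊕ Fin g → ℤ) (s : Torus n) (c : Fin g ⊕ Fin g → Torus n) :
    Fin g ⊕ Fin g → Torus n :=
  fun k => c k * s ^ pairing w k

theorem shear_one (w : Fin g ⊕ Fin g → ℤ) (c : Fin g ⊕ Fin g → Torus n) : shear w 1 c = c := by
  funext k
  simp [shear]

theorem continuous_shear (w : Fin g ⊕ Fin g → ℤ) (c : Fin g ⊕ Fin g → Torus n) :
    Continuous fun s => shear w s c := by
  unfold shear
  fun_prop

/-- Invariance of a set of representations, in coordinates, under the positive powers of all
transvections. -/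
def TransvectionInvariant (X : Set (Fin g ⊕ Fin g → Torus n)) : Prop :=
  ∀ c ∈ X, ∀ w, ∀ k : ℕ, shear w (evalAt c w ^ k) c ∈ X

theorem TransvectionInvariant.closure_invariant {X : Set (Fin g ⊕ Fin g → Torus n)}
    (hX : TransvectionInvariant X) : TransvectionInvariant (closure X) := by
  intro c hc w k
  have hcont : Continuous fun c : Fin g ⊕ Fin g → Torus n => shear w (evalAt c w ^ k) c := by
    have := continuous_evalAt (n := n) w
    unfold shear
    fun_prop
  exact map_mem_closure (f := fun c => shear w (evalAt c w ^ k) c) hcont hc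
    fun c hc => hX c hc w k

/-- If `evalAt c w` is generic, a closed invariant set containing `c` contains all its translates
by multiples of the pairing with `w`. -/
theorem TransvectionInvariant.shear_mem {X : Set (Fin g ⊕ Fin g → Torus n)} (hcl : IsClosed X)
    (hX : TransvectionInvariant X) {c : Fin g ⊕ Fin g → Torus n} (hc : c ∈ X)
    {w : Fin g ⊕ Fin g → ℤ} (hw : IsGeneric (evalAt c w)) (s : Torus n) : shear w s c ∈ X := by
  have hsub : closure (Set.range fun k : ℕ => evalAt c w ^ k) ⊆ (fun s => shear w s c) ⁻¹' X := by
    refine closure_minimal ?_ (hcl.preimage (continuous_shear w c))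
    rintro _ ⟨k, rfl⟩
    exact hX c hc w k
  exact hsub (hw.dense_range_pow s)

theorem TransvectionInvariant.update_inr_mem {X : Set (Fin g ⊕ Fin g → Torus n)}
    (hcl : IsClosed X) (hX : TransvectionInvariant X) {c : Fin g ⊕ Fin g → Torus n} (hc : c ∈ X)
    {i : Fin g} (hi : IsGeneric (c (Sum.inl i))) (t : Torus n) :
    Function.update c (Sum.inr i) t ∈ X := by
  have h := hX.shear_mem hcl hc (w := Pi.single (Sum.inl i) 1) (by rwa [evalAt_single])
    ((c (Sum.inr i))⁻¹ * t)
  convert h using 1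
  funext k
  rw [shear, pairing_single_inl]
  by_cases hk : k = Sum.inr i
  · subst hk
    simp
  · simp [hk]

theorem TransvectionInvariant.update_inl_mem {X : Set (Fin g ⊕ Fin g → Torus n)}
    (hcl : IsClosed X) (hX : TransvectionInvariant X) {c : Fin g ⊕ Fin g → Torus n} (hc : c ∈ X)
    {i : Fin g} (hi : IsGeneric (c (Sum.inr i))) (t : Torus n) :
    Function.update c (Sum.inl i) t ∈ X := by
  have h := hX.shear_mem hcl hc (w := Pi.single (Sum.inr i) 1) (by rwa [evalAt_single])
    (t⁻¹ * c (Sum.inl i))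
  convert h using 1
  funext k
  rw [shear, pairing_single_inr]
  by_cases hk : k = Sum.inl i
  · subst hk
    simp
  · simp [hk]

/-- In a closed invariant set, both values on a symplectic pair of basis vectors may be changed at
will, as soon as the first one is generic. -/
theorem TransvectionInvariant.update_pair_mem {X : Set (Fin g ⊕ Fin g → Torus n)}
    (hcl : IsClosed X) (hX : TransvectionInvariant X) {c : Fin g ⊕ Fin g → Torus n} (hc : c ∈ X)
    {i : Fin g} (hi : IsGeneric (c (Sum.inl i))) (s t : Torus n) :
    Function.update (Function.update c (Sum.inl i) s) (Sum.inr i) t ∈ X := by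
  have hcont : Continuous fun t : Torus n =>
      Function.update (Function.update c (Sum.inl i) s) (Sum.inr i) t :=
    continuous_const.update _ continuous_id
  -- the positive powers of a generic point are generic and dense
  have hsub : closure (Set.range fun k : ℕ => c (Sum.inl i) ^ (k + 1)) ⊆
      (fun t => Function.update (Function.update c (Sum.inl i) s) (Sum.inr i) t) ⁻¹' X := by
    refine closure_minimal ?_ (hcl.preimage hcont)
    rintro _ ⟨k, rfl⟩
    have h := hX.update_inl_mem hcl (hX.update_inr_mem hcl hc hi (c (Sum.inl i) ^ (k + 1)))
      (i := i) (by simpa using hi.pow k.succ_ne_zero) s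
    rwa [Function.update_comm (by simp)] at h
  exact hsub (hi.dense_range_pow_succ t)

/-- A closed invariant set is everything if it contains a representation with generic values on
the first half of the symplectic basis. -/
theorem TransvectionInvariant.eq_univ {X : Set (Fin g ⊕ Fin g → Torus n)} (hcl : IsClosed X)
    (hX : TransvectionInvariant X) {c : Fin g ⊕ Fin g → Torus n} (hc : c ∈ X)
    (hgen : ∀ i, IsGeneric (c (Sum.inl i))) : X = Set.univ := by
  have key : ∀ F : Finset (Fin g), ∀ d : Fin g ⊕ Fin g → Torus n,
      (∀ i ∉ F, d (Sum.inl i) = c (Sum.inl i) ∧ d (Sum.inr i) = c (Sum.inr i)) → d ∈ X := by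
    intro F
    induction F using Finset.induction_on with
    | empty =>
      intro d hd
      convert hc using 1
      funext k
      rcases k with i | i
      · exact (hd i (by simp)).1
      · exact (hd i (by simp)).2
    | insert i F hiF ih =>
      intro d hd
      set d₁ := Function.update (Function.update d (Sum.inl i) (c (Sum.inl i))) (Sum.inr i)
        (c (Sum.inr i)) with hd₁
      have h₁ : d₁ ∈ X := by
        refine ih d₁ fun j hj => ?_
        by_cases hji : j = i
        · subst hji
          simp [hd₁]
        · simpa [hd₁, hji] using hd j (by simp [hji, hj])
      have h := hX.update_pair_mem hcl h₁ (i := i) (by simpa [hd₁] using hgen i)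
        (d (Sum.inl i)) (d (Sum.inr i))
      convert h using 1
      funext k
      rcases k with j | j
      · by_cases hji : j = i
        · subst hji
          simp
        · simp [hd₁, hji]
      · by_cases hji : j = i
        · subst hji
          simp
        · simp [hd₁, hji]
  exact Set.eq_univ_of_forall fun d => key Finset.univ d (by simp)

/-! ### Producing generic values by a Baire category argument -/

/-- A nontrivial character has a value of infinite order on a dense subgroup `evalAt c '' ℤ^{2g}`
of the torus. -/
theorem exists_not_isOfFinOrder {c : Fin g ⊕ Fin g → Torus n} (hc : Dense (Set.range (evalAt c)))
    {m : Fin n → ℤ} (hm : m ≠ 0) : ∃ v, ¬ IsOfFinOrder (character m (evalAt c v)) := by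
  by_contra! hcon
  have hk : ∀ k, IsOfFinOrder (character m (c k)) := fun k => by
    simpa [evalAt_single] using hcon (Pi.single k 1)
  set N : ℕ := ∏ k, orderOf (character m (c k)) with hN
  have hN0 : (N : ℤ) ≠ 0 := by
    exact_mod_cast Finset.prod_ne_zero_iff.2 fun k _ => (hk k).orderOf_pos.ne'
  have hone : ∀ k, character m (c k) ^ N = 1 := fun k =>
    orderOf_dvd_iff_pow_eq_one.1 (Finset.dvd_prod_of_mem _ (Finset.mem_univ k))
  -- the character with exponents `N • m` is trivial on a dense subset
  have hcl : closure (Set.range (evalAt c)) ⊆ {t | character ((N : ℤ) • m) t = 1} := by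
    refine closure_minimal ?_ (isClosed_eq (continuous_character _) continuous_const)
    rintro _ ⟨v, rfl⟩
    rw [Set.mem_ofPred_eq, character_zsmul, zpow_natCast, evalAt, map_prod, ← Finset.prod_pow]
    refine Finset.prod_eq_one fun k _ => ?_
    rw [map_zpow, ← zpow_natCast, zpow_comm, zpow_natCast, hone, one_zpow]
  obtain ⟨t, ht⟩ := exists_character_ne_one (smul_ne_zero hN0 hm)
  exact ht (hcl (hc t))

/-- The vector of `exists_not_isOfFinOrder` may be chosen to have nonzero intersection number with the
`i`-th basis vector, as a group is not the union of two proper subgroups. -/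
theorem exists_not_isOfFinOrder_pairing_ne_zero {c : Fin g ⊕ Fin g → Torus n}
    (hc : Dense (Set.range (evalAt c))) {m : Fin n → ℤ} (hm : m ≠ 0) (i : Fin g) :
    ∃ w, ¬ IsOfFinOrder (character m (evalAt c w)) ∧ pairing w (Sum.inl i) ≠ 0 := by
  obtain ⟨v, hv⟩ := exists_not_isOfFinOrder hc hm
  by_cases hv0 : pairing v (Sum.inl i) = 0
  · set u : Fin g ⊕ Fin g → ℤ := Pi.single (Sum.inr i) 1
    have hu0 : pairing u (Sum.inl i) ≠ 0 := by simp [u, pairing_single_inr]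
    by_cases hu : IsOfFinOrder (character m (evalAt c u))
    · refine ⟨u + v, fun h => hv ?_, ?_⟩
      · have h' := hu.inv.mul h
        rwa [evalAt_add, map_mul, inv_mul_cancel_left] at h'
      · rw [pairing_add, Pi.add_apply, hv0, add_zero]
        exact hu0
    · exact ⟨u, hu, hu0⟩
  · exact ⟨v, hv, hv0⟩

/-- Arbitrarily small moves along transvections make a given character nontrivial on the value at
a given basis vector: some power of the transvection is as close to the identity as desired, by
recurrence in the compact torus. -/
theorem TransvectionInvariant.subset_closure_character_ne_one
    {O : Set (Fin g ⊕ Fin g → Torus n)} (hO : TransvectionInvariant O)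
    (hdense : ∀ c ∈ O, Dense (Set.range (evalAt c))) {m : Fin n → ℤ} (hm : m ≠ 0) (i : Fin g) :
    O ⊆ closure (O ∩ {c | character m (c (Sum.inl i)) ≠ 1}) := by
  intro c hc
  by_cases h1 : character m (c (Sum.inl i)) = 1
  · obtain ⟨w, hw, hwi⟩ := exists_not_isOfFinOrder_pairing_ne_zero (hdense c hc) hm i
    have hcluster : MapClusterPt c atTop fun k : ℕ => shear w (evalAt c w ^ k) c := by
      have h := (mapClusterPt_one_atTop_pow (evalAt c w)).continuousAt_comp
        (continuous_shear w c).continuousAt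
      rwa [shear_one] at h
    have hev : ∀ᶠ k : ℕ in atTop, shear w (evalAt c w ^ k) c ∈
        O ∩ {c | character m (c (Sum.inl i)) ≠ 1} := by
      filter_upwards [eventually_ne_atTop 0] with k hk
      refine ⟨hO c hc w k, fun h => hw ?_⟩
      rw [shear, map_mul, h1, one_mul, map_zpow, map_pow, ← zpow_natCast, ← zpow_mul] at h
      exact isOfFinOrder_iff_zpow_eq_one.2
        ⟨_, mul_ne_zero (by exact_mod_cast hk) hwi, h⟩
    refine mem_closure_iff_nhds.2 fun V hV => ?_
    obtain ⟨k, hkV, hk⟩ := ((mapClusterPt_iff_frequently.1 hcluster V hV).and_eventually hev).exists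
    exact ⟨_, hkV, hk⟩
  · exact subset_closure ⟨hc, h1⟩

theorem TransvectionInvariant.exists_generic {O : Set (Fin g ⊕ Fin g → Torus n)}
    (hO : TransvectionInvariant O) (hne : O.Nonempty)
    (hdense : ∀ c ∈ O, Dense (Set.range (evalAt c))) :
    ∃ c ∈ closure O, ∀ i, IsGeneric (c (Sum.inl i)) := by
  have : CompactSpace (closure O) := isCompact_iff_compactSpace.1 isClosed_closure.isCompact
  have : Nonempty (closure O) := hne.closure.to_subtype
  let U : Fin g × {m : Fin n → ℤ // m ≠ 0} → Set (closure O) := fun p =>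
    {c | character p.2.1 (c.1 (Sum.inl p.1)) ≠ 1}
  have hopen : ∀ p, IsOpen (U p) := fun p =>
    isOpen_ne_fun ((continuous_character _).comp
      ((continuous_apply _).comp continuous_subtype_val)) continuous_const
  have hU : ∀ p, Dense (U p) := fun p => by
    rw [Subtype.dense_iff]
    refine closure_minimal ?_ isClosed_closure
    refine (hO.subset_closure_character_ne_one hdense p.2.2 p.1).trans (closure_mono ?_)
    rintro c ⟨hc, h⟩
    exact ⟨⟨c, subset_closure hc⟩, h, rfl⟩
  obtain ⟨c, hc⟩ := (dense_iInter_of_isOpen hopen hU).nonempty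
  exact ⟨c.1, c.2, fun i m hm => Set.mem_iInter.1 hc (i, ⟨m, hm⟩)⟩

/-- A nonempty transvection-invariant set of representations with dense image is dense. -/
theorem TransvectionInvariant.dense {O : Set (Fin g ⊕ Fin g → Torus n)}
    (hO : TransvectionInvariant O) (hne : O.Nonempty)
    (hdense : ∀ c ∈ O, Dense (Set.range (evalAt c))) : Dense O := by
  obtain ⟨c, hc, hgen⟩ := hO.exists_generic hne hdense
  exact dense_iff_closure_eq.2 (hO.closure_invariant.eq_univ isClosed_closure hc hgen)

end Torus

/-! ### Coordinates on homology and on the representation space -/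

namespace H1

variable {S : Type*} [TopologicalSpace S] {x : S} {g : ℕ}
  (e : SurfaceGroup g ≃* FundamentalGroup S x)

/-- The classes of the standard generators. -/
noncomputable def basis (k : Fin g ⊕ Fin g) : H1 S x :=
  Abelianization.of (e (PresentedGroup.of k))

/-- The homology class with given coordinates. -/
noncomputable def ofCoords (w : Fin g ⊕ Fin g → ℤ) : H1 S x := ∏ k, basis e k ^ w k

/-- `H1.coords` as a homomorphism. -/
noncomputable def coordsHom : H1 S x →* Multiplicative (Fin g ⊕ Fin g → ℤ) :=
  Abelianization.lift ((SurfaceGroup.exponents g).comp e.symm.toMonoidHom)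

theorem toAdd_coordsHom (a : H1 S x) : Multiplicative.toAdd (coordsHom e a) = coords e a := rfl

theorem coords_one : coords e (1 : H1 S x) = 0 := by
  rw [← toAdd_coordsHom, map_one, toAdd_one]

theorem coords_mul (a b : H1 S x) : coords e (a * b) = coords e a + coords e b := by
  simp only [← toAdd_coordsHom, map_mul, toAdd_mul]

theorem coords_zpow (a : H1 S x) (k : ℤ) : coords e (a ^ k) = k • coords e a := by
  simp only [← toAdd_coordsHom, map_zpow, toAdd_zpow]

theorem coords_basis (k : Fin g ⊕ Fin g) : coords e (basis e k) = Pi.single k 1 := by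
  change Multiplicative.toAdd (SurfaceGroup.exponents g (e.symm (e (PresentedGroup.of k)))) = _
  rw [MulEquiv.symm_apply_apply, SurfaceGroup.exponents, PresentedGroup.toGroup.of, toAdd_ofAdd]

theorem coords_ofCoords (w : Fin g ⊕ Fin g → ℤ) : coords e (ofCoords e w) = w := by
  rw [ofCoords, ← toAdd_coordsHom, map_prod, toAdd_prod]
  simp only [map_zpow, toAdd_zpow, toAdd_coordsHom, coords_basis]
  funext l
  simp [Finset.sum_apply, Pi.single_apply]

/-- Two homomorphisms on homology agree if they agree on the classes of the generators. -/
theorem hom_ext {A : Type*} [CommGroup A] {φ ψ : H1 S x →* A}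
    (h : ∀ k, φ (basis e k) = ψ (basis e k)) : φ = ψ := by
  have h1 : (φ.comp Abelianization.of).comp e.toMonoidHom =
      (ψ.comp Abelianization.of).comp e.toMonoidHom := PresentedGroup.ext h
  refine Abelianization.hom_ext φ ψ (MonoidHom.ext fun y => ?_)
  have h2 : φ (Abelianization.of (e (e.symm y))) = ψ (Abelianization.of (e (e.symm y))) :=
    DFunLike.congr_fun h1 (e.symm y)
  rw [MulEquiv.apply_symm_apply] at h2
  exact h2

/-- A homomorphism is determined by its values on the basis through the coordinates. -/
theorem map_eq_prod {A : Type*} [CommGroup A] (φ : H1 S x →* A) (a : H1 S x) :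
    φ a = ∏ k, φ (basis e k) ^ coords e a k := by
  let ψ : H1 S x →* A :=
    { toFun := fun a => ∏ k, φ (basis e k) ^ coords e a k
      map_one' := by simp [coords_one]
      map_mul' := fun a b => by
        simp [coords_mul, zpow_add, Finset.prod_mul_distrib] }
  have h : φ = ψ := hom_ext e fun k => by
    change _ = ∏ l, φ (basis e l) ^ coords e (basis e k) l
    rw [coords_basis, Finset.prod_eq_single k]
    · rw [Pi.single_eq_same, zpow_one]
    · intro l _ hl
      rw [Pi.single_eq_of_ne hl, zpow_zero]
    · simp
  exact DFunLike.congr_fun h a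

theorem intersection_mul_left (a b c : H1 S x) :
    intersection e (a * b) c = intersection e a c + intersection e b c := by
  simp only [intersection, coords_mul, Pi.add_apply, ← Finset.sum_add_distrib]
  exact Finset.sum_congr rfl fun i _ => by ring

theorem intersection_swap (a b : H1 S x) : intersection e b a = -intersection e a b := by
  simp only [intersection, ← Finset.sum_neg_distrib]
  exact Finset.sum_congr rfl fun i _ => by ring

theorem intersection_zpow_left (a b : H1 S x) (k : ℤ) :
    intersection e (a ^ k) b = k * intersection e a b := by
  simp only [intersection, coords_zpow, Pi.smul_apply, smul_eq_mul, Finset.mul_sum]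
  exact Finset.sum_congr rfl fun i _ => by ring

theorem intersection_mul_right (a b c : H1 S x) :
    intersection e a (b * c) = intersection e a b + intersection e a c := by
  rw [intersection_swap, intersection_mul_left, intersection_swap e a b, intersection_swap e a c,
    neg_add, neg_neg, neg_neg]

theorem intersection_zpow_right (a b : H1 S x) (k : ℤ) :
    intersection e a (b ^ k) = k * intersection e a b := by
  rw [intersection_swap, intersection_zpow_left, intersection_swap e a b]
  ring

theorem intersection_self (a : H1 S x) : intersection e a a = 0 := by
  have := intersection_swap e a a
  omega

theorem intersection_basis_right (a : H1 S x) (k : Fin g ⊕ Fin g) :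
    intersection e a (basis e k) = Torus.pairing (coords e a) k := by
  rw [intersection, coords_basis]
  rcases k with i | i <;> simp [Torus.pairing, Pi.single_apply]

/-- The `k`-th power of the transvection `a ↦ a + (w ∩ a) w` along the class `w`, written
multiplicatively. -/
noncomputable def transvection (w : H1 S x) (k : ℤ) : MulAut (H1 S x) where
  toFun a := a * w ^ (k * intersection e w a)
  invFun a := a * w ^ (-k * intersection e w a)
  left_inv a := by
    simp only [intersection_mul_right, intersection_zpow_right, intersection_self, mul_zero,
      add_zero]
    rw [neg_mul, zpow_neg, mul_inv_cancel_right]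
  right_inv a := by
    simp only [intersection_mul_right, intersection_zpow_right, intersection_self, mul_zero,
      add_zero]
    rw [neg_mul, zpow_neg, inv_mul_cancel_right]
  map_mul' a b := by
    rw [intersection_mul_right, mul_add, zpow_add]
    exact mul_mul_mul_comm _ _ _ _

theorem transvection_apply (w a : H1 S x) (k : ℤ) :
    transvection e w k a = a * w ^ (k * intersection e w a) := rfl

theorem transvection_mem_Sp (w : H1 S x) (k : ℤ) : transvection e w k ∈ Sp e := by
  intro a b
  simp only [transvection_apply, intersection_mul_right, intersection_mul_left,
    intersection_zpow_left, intersection_zpow_right, intersection_self, intersection_swap e w a]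
  ring

end H1

namespace HomologicalRep

variable {S : Type*} [TopologicalSpace S] {x : S} {g n : ℕ}
  (e : SurfaceGroup g ≃* FundamentalGroup S x)

/-- The values of a representation on the classes of the generators. -/
noncomputable def values (ρ : HomologicalRep S x n) : Fin g ⊕ Fin g → Torus n :=
  fun k => ρ (H1.basis e k)

theorem evalAt_values (ρ : HomologicalRep S x n) (a : H1 S x) :
    Torus.evalAt (values e ρ) (H1.coords e a) = ρ a :=
  (H1.map_eq_prod e ρ.toMonoidHom a).symm

theorem range_evalAt_values (ρ : HomologicalRep S x n) :
    Set.range (Torus.evalAt (values e ρ)) = Set.range ρ := by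
  ext t
  constructor
  · rintro ⟨w, rfl⟩
    exact ⟨H1.ofCoords e w, by rw [← evalAt_values e, H1.coords_ofCoords]⟩
  · rintro ⟨a, rfl⟩
    exact ⟨H1.coords e a, evalAt_values e ρ a⟩

/-- The representation with given values on the classes of the generators. -/
noncomputable def ofValues (c : Fin g ⊕ Fin g → Torus n) : HomologicalRep S x n where
  toFun a := Torus.evalAt c (H1.coords e a)
  map_one' := by simp [H1.coords_one, Torus.evalAt]
  map_mul' a b := by rw [H1.coords_mul, Torus.evalAt_add]
  continuous_toFun := continuous_of_discreteTopology

theorem ofValues_apply (c : Fin g ⊕ Fin g → Torus n) (a : H1 S x) :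
    ofValues e c a = Torus.evalAt c (H1.coords e a) := rfl

/-- The representation space is the torus `(𝕋ⁿ)^{2g}`. -/
noncomputable def valuesHomeomorph :
    HomologicalRep S x n ≃ₜ (Fin g ⊕ Fin g → Torus n) where
  toFun := values e
  invFun := ofValues e
  left_inv ρ := ContinuousMonoidHom.ext fun a => evalAt_values e ρ a
  right_inv c := by
    funext k
    rw [values, ofValues_apply, H1.coords_basis, Torus.evalAt_single]
  continuous_toFun := continuous_pi fun k => continuous_eval_const _
  continuous_invFun := by
    refine (ContinuousMonoidHom.isInducing_toContinuousMap _ _).continuous_iff.2 ?_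
    refine ContinuousMap.homeoFnOfDiscrete.isInducing.continuous_iff.2 ?_
    exact continuous_pi fun a => Torus.continuous_evalAt (H1.coords e a)

theorem smul_apply (φ : MulAut (H1 S x)) (ρ : HomologicalRep S x n) (a : H1 S x) :
    (φ • ρ) a = ρ (φ⁻¹ a) := rfl

theorem range_smul (φ : MulAut (H1 S x)) (ρ : HomologicalRep S x n) :
    Set.range (φ • ρ) = Set.range ρ :=
  (φ⁻¹ : MulAut (H1 S x)).surjective.range_comp ρ

/-- In coordinates, transvections act by shears. -/
theorem values_transvection_smul (ρ : HomologicalRep S x n) (w : H1 S x) (k : ℤ) :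
    values e ((H1.transvection e w k)⁻¹ • ρ) =
      Torus.shear (H1.coords e w) (ρ w ^ k) (values e ρ) := by
  funext l
  rw [values, smul_apply, inv_inv, H1.transvection_apply, map_mul, map_zpow,
    H1.intersection_basis_right, zpow_mul]
  rfl

/-- The orbit of a representation is invariant under transvections, in coordinates. -/
theorem transvectionInvariant_image_orbit (ρ : HomologicalRep S x n) :
    Torus.TransvectionInvariant (values e '' MulAction.orbit (H1.Sp e) ρ) := by
  rintro _ ⟨σ, hσ, rfl⟩ w k
  let τ : H1.Sp e := ⟨H1.transvection e (H1.ofCoords e w) k, H1.transvection_mem_Sp e _ _⟩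
  refine ⟨τ⁻¹ • σ, MulAction.mem_orbit_of_mem_orbit τ⁻¹ hσ, ?_⟩
  have h := values_transvection_smul e σ (H1.ofCoords e w) k
  rw [H1.coords_ofCoords, ← evalAt_values e, H1.coords_ofCoords, zpow_natCast] at h
  exact h

end HomologicalRep

/-! ### The density criterion -/

theorem theoremB {S : Type*} [TopologicalSpace S] [T2Space S] [CompactSpace S] [ConnectedSpace S]
    [ChartedSpace (EuclideanSpace ℝ (Fin 2)) S] (x : S) {g : ℕ} (hg : 1 ≤ g)
    (e : SurfaceGroup g ≃* FundamentalGroup S x) {n : ℕ} (ρ : HomologicalRep S x n) :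
    Dense (Set.range ρ) ↔ Dense (MulAction.orbit (H1.Sp e) ρ) := by
  have hrange : ∀ σ ∈ MulAction.orbit (H1.Sp e) ρ, Set.range σ = Set.range ρ := by
    rintro _ ⟨φ, rfl⟩
    exact HomologicalRep.range_smul φ.1 ρ
  constructor
  · intro hρ
    have hdense : Dense (HomologicalRep.values e '' MulAction.orbit (H1.Sp e) ρ) := by
      refine (HomologicalRep.transvectionInvariant_image_orbit e ρ).dense
        ((MulAction.nonempty_orbit ρ).image _) ?_
      rintro _ ⟨σ, hσ, rfl⟩
      rw [HomologicalRep.range_evalAt_values, hrange σ hσ]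
      exact hρ
    have h := (HomologicalRep.valuesHomeomorph (n := n) e).symm.surjective.denseRange.dense_image
      (HomologicalRep.valuesHomeomorph e).symm.continuous hdense
    rwa [show HomologicalRep.values e = HomologicalRep.valuesHomeomorph (n := n) e from rfl,
      Set.image_image, Set.image_congr fun σ _ => Homeomorph.symm_apply_apply _ σ,
      Set.image_id'] at h
  · intro horb
    -- evaluation at `α₁` maps the representation space onto the torus and the orbit into the image
    let a : H1 S x := H1.basis e (Sum.inl ⟨0, hg⟩)
    have hsurj : Function.Surjective fun σ : HomologicalRep S x n => σ a := fun t =>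
      ⟨HomologicalRep.ofValues e fun _ => t, by
        change HomologicalRep.ofValues e (fun _ => t) a = t
        rw [HomologicalRep.ofValues_apply, H1.coords_basis, Torus.evalAt_single]⟩
    refine (hsurj.denseRange.dense_image (continuous_eval_const a) horb).mono ?_
    rintro _ ⟨σ, hσ, rfl⟩
    rw [← hrange σ hσ]
    exact ⟨a, rfl⟩
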